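/- For real numbers $a>0$ and $R\ge 0$ let $\mathfrak D(a)=\{t\in\mathbb C:\operatorname{dist}(t,(0,+\infty))<a\}$, and let $H(a,R)$ be the set of all functions $F$ analytic in $\mathfrak D(a)$ that have exponential growth of type $R$ at infinity there: for all $0<A<a$ and $r>R$ there is a constant $C$ with $|F(t)|\le Ce^{r|t|}$ for all $t\in\mathfrak D(A)$. Let $H=\bigcup_{a>0,\,R\ge 0}H(a,R)$. For $\Re\alpha>-1$ and $F\in H$ put $$\mathcal L\{F\}(\zeta)=\zeta\int_0^\infty e^{-\zeta t}F(t)\,dt,\qquad \mathcal L_\alpha\{F\}(\zeta)=\zeta^{\alpha}\mathcal L\{t^\alpha F\}(\zeta)=\zeta^{1+\alpha}\int_0^\infty e^{-\zeta t}t^\alpha F(t)\,dt$$ for all $\zeta$ in some right half-plane, with principal powers, and let $\mathcal D_\alpha=\mathcal L^{-1}\mathcal L_\alpha$ and $\mathcal I_\alpha=\mathcal L_\alpha^{-1}\mathcal L$ be the fractional differentiation and integration operators on $H$; that is, $\mathcal D_\alpha\{F\}$ is the element $G$ of $H$ with $\mathcal L\{G\}=\mathcal L_\alpha\{F\}$ on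 some right half-plane, and $\mathcal I_\alpha\{F\}$ is the element $G$ of $H$ with $\mathcal L_\alpha\{G\}=\mathcal L\{F\}$ on some right half-plane. **Theorem 4.** Let $a>0$, $R\ge 0$, $\alpha\in\mathbb C$ with $\Re\alpha>-1$, and $F\in H(a,R)$. Then for every $\zeta\in\mathbb C$ with $\Re\zeta>R$ $$\zeta\int_0^\infty e^{-\zeta t}t^\alpha F(t)\,dt=\zeta^{1-\alpha}\int_0^\infty e^{-\zeta t}\,\mathcal D_\alpha\{F\}(t)\,dt,$$ $$\zeta\int_0^\infty e^{-\zeta t}F(t)\,dt=\zeta^{1+\alpha}\int_0^\infty e^{-\zeta t}t^\alpha\,\mathcal I_\alpha\{F\}(t)\,dt,$$ and all four integrals are absolutely convergent. -/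

import Mathlib

open Set MeasureTheory

noncomputable section

namespace FracCalc

/-- The region of all complex `t` whose distance to the positive half-line is less than `a`. -/
def region (a : ℝ) : Set ℂ :=
  {t : ℂ | Metric.infDist t ((fun x : ℝ => (x : ℂ)) '' Ioi (0 : ℝ)) < a}

/-- `F` is analytic in `region a` and has exponential growth of type `R` at infinity there:
in every smaller region it is bounded by a constant times `exp (r |t|)`, for every `r > R`.
Functions are total; values off `region a` play no role. -/
def H (a R : ℝ) : Set (ℂ → ℂ) :=
  {F | DifferentiableOn ℂ F (region a) ∧
    ∀ A : ℝ, 0 < A → A < a → ∀ r : ℝ, R < r →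
      ∃ C : ℝ, ∀ t ∈ region A, ‖F t‖ ≤ C * Real.exp (r * ‖t‖)}

/-- The operator `F ↦ ζ ∫₀^∞ e^{-ζ t} F(t) dt`. -/
def laplace (F : ℂ → ℂ) (ζ : ℂ) : ℂ :=
  ζ * ∫ t in Ioi (0 : ℝ), Complex.exp (-ζ * (t : ℂ)) * F (t : ℂ)

/-- The operator `L_α F (ζ) = ζ^α L(t^α F)(ζ)` (principal powers). -/
def laplaceAlpha (α : ℂ) (F : ℂ → ℂ) (ζ : ℂ) : ℂ :=
  ζ ^ α * laplace (fun t => t ^ α * F t) ζ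

/-- Two functions of `ζ` agree on some right half-plane. -/
def EqHalfPlane (P Q : ℂ → ℂ) : Prop :=
  ∃ ρ : ℝ, ∀ ζ : ℂ, ρ < ζ.re → P ζ = Q ζ

open Classical in
/-- The inverse, with values in the union of all `H b ρ` with `b > 0` and `ρ ≥ 0`, of an operator
`T` on that union: the value at `t` is `G t`, where `G ∈ H b ρ`, `t ∈ region b`, and `T G = P`.
The regions are nested, so for an injective `T` the value does not depend on the choice of `G`.
The value is `0` where there is no such `G`. -/
def invOp (T : (ℂ → ℂ) → ℂ → ℂ) (P : ℂ → ℂ) (t : ℂ) : ℂ :=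
  if h : ∃ G : ℂ → ℂ, (∃ b ρ : ℝ, 0 < b ∧ 0 ≤ ρ ∧ G ∈ H b ρ ∧ t ∈ region b) ∧
      EqHalfPlane (T G) P
  then h.choose t else 0

/-- Fractional differentiation of order `α`: the operator `L⁻¹ L_α`. -/
def fracD (α : ℂ) (F : ℂ → ℂ) : ℂ → ℂ := invOp laplace (laplaceAlpha α F)

/-- Fractional integration of order `α`: the operator `L_α⁻¹ L`. -/
def fracI (α : ℂ) (F : ℂ → ℂ) : ℂ → ℂ := invOp (laplaceAlpha α) (laplace F)

end FracCalc

end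

/-!
The integrals only see the positive axis, so the point is to exhibit, for `F ∈ H a R`, functions in
the same class `H a R` (same region, same type) that solve the equations defining `fracD α F` and
`fracI α F` for all `Re ζ > R`, and to know that these equations determine a function on the
positive axis.

*Existence.* Two operators preserve `H a R`. The Euler operator `eulerOp c F = c F + t F'` does by
Cauchy's estimate; the beta-kernel average
`betaOp p q F (t) = ∫₀¹ u ^ (q - 1) (1 - u) ^ (p - 1) F (u t) du` does because the regions are
star-shaped about `0`. Their Laplace integrals are known: `t ^ (c - 1) * eulerOp c F` is the
derivative of `t ^ c F` (`integral_laplace_eulerOp`), and `t ^ (p + q - 1) * betaOp p q F` is the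
convolution of `t ^ (q - 1) F` with `t ^ (p - 1)`, so its Laplace integral is `Γ(p) ζ ^ (-p)` times
that of `t ^ (q - 1) F` (`integral_laplace_betaOp`). Hence

* `eulerOp (α + 1) (betaOp (α + 1) 1 F) / Γ(α + 1)` is the fractional integral, for every
  `Re α > -1` (`exists_fracI`);
* `eulerOp 1 (betaOp (1 - α) (α + 1) F) / Γ(1 - α)` is the fractional derivative if `|Re α| < 1`,
  and an order `α` with `Re α ≥ 1` is reduced to `α - 1` by replacing `F` with `eulerOp α F`
  (`exists_fracD`).

*Uniqueness.* A continuous function on the half-line whose Laplace integral vanishes on a vertical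
line of absolute convergence is zero, by Fourier inversion (`eq_zero_of_laplace_eq_zero`). So
whichever preimage `invOp` selects at a point `t > 0`, its value there is that of the function
constructed above (`invOp_laplaceAlpha_eq`).
-/

namespace FracCalc

open Filter Topology

/-! ### The regions and the growth classes -/

lemma mem_region_iff {A : ℝ} {t : ℂ} :
    t ∈ region A ↔ ∃ x : ℝ, 0 < x ∧ dist t x < A := by
  have hne : ((fun x : ℝ => (x : ℂ)) '' Ioi (0 : ℝ)).Nonempty := ⟨_, 1, one_pos (α := ℝ), rfl⟩
  simp [region, Metric.infDist_lt_iff hne]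

lemma isOpen_region (A : ℝ) : IsOpen (region A) :=
  isOpen_lt (Metric.continuous_infDist_pt _) continuous_const

lemma region_mono {A B : ℝ} (h : A ≤ B) : region A ⊆ region B := fun _ ht => lt_of_lt_of_le ht h

lemma ofReal_mem_region {A x : ℝ} (hA : 0 < A) (hx : 0 ≤ x) : (x : ℂ) ∈ region A := by
  refine mem_region_iff.2 ⟨x + A / 2, by linarith, ?_⟩
  rw [Complex.dist_of_im_eq (by simp), Real.dist_eq]
  simp only [Complex.ofReal_re]
  rw [abs_lt]
  constructor <;> linarith

lemma mem_region_of_dist_le {A δ : ℝ} {s t : ℂ} (ht : t ∈ region A) (h : dist s t ≤ δ) :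
    s ∈ region (A + δ) := by
  obtain ⟨x, hx, hxt⟩ := mem_region_iff.1 ht
  exact mem_region_iff.2 ⟨x, hx, by linarith [dist_triangle s t x]⟩

lemma exists_mem_region_lt {a : ℝ} {t : ℂ} (ht : t ∈ region a) :
    ∃ A, 0 < A ∧ A < a ∧ t ∈ region A := by
  obtain ⟨x, hx, hxt⟩ := mem_region_iff.1 ht
  have h0 : 0 ≤ dist t x := dist_nonneg
  exact ⟨(dist t x + a) / 2, by linarith, by linarith, mem_region_iff.2 ⟨x, hx, by linarith⟩⟩

/-- The regions are star-shaped about the origin. -/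
lemma ofReal_mul_mem_region {A u : ℝ} {t : ℂ} (ht : t ∈ region A) (h0 : 0 < u) (h1 : u ≤ 1) :
    (u : ℂ) * t ∈ region A := by
  obtain ⟨x, hx, hxt⟩ := mem_region_iff.1 ht
  refine mem_region_iff.2 ⟨u * x, by positivity, ?_⟩
  rw [Complex.ofReal_mul, dist_eq_norm, ← mul_sub, norm_mul, Complex.norm_real,
    Real.norm_of_nonneg h0.le, ← dist_eq_norm]
  nlinarith [dist_nonneg (x := t) (y := (x : ℂ))]

/-- A growth bound with a nonnegative constant. -/
lemma H.exists_bound {a R A r : ℝ} {F : ℂ → ℂ} (hF : F ∈ H a R) (hA : 0 < A) (hAa : A < a)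
    (hr : R < r) : ∃ C, 0 ≤ C ∧ ∀ t ∈ region A, ‖F t‖ ≤ C * Real.exp (r * ‖t‖) := by
  obtain ⟨C, hC⟩ := hF.2 A hA hAa r hr
  refine ⟨|C|, abs_nonneg _, fun t ht => (hC t ht).trans ?_⟩
  gcongr
  exact le_abs_self C

lemma H.add {a R : ℝ} {F G : ℂ → ℂ} (hF : F ∈ H a R) (hG : G ∈ H a R) :
    (fun t => F t + G t) ∈ H a R := by
  refine ⟨hF.1.add hG.1, fun A hA hAa r hr => ?_⟩
  obtain ⟨C, hC⟩ := hF.2 A hA hAa r hr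
  obtain ⟨D, hD⟩ := hG.2 A hA hAa r hr
  refine ⟨C + D, fun t ht => (norm_add_le _ _).trans ?_⟩
  rw [add_mul]
  exact add_le_add (hC t ht) (hD t ht)

lemma H.const_mul {a R : ℝ} {F : ℂ → ℂ} (c : ℂ) (hF : F ∈ H a R) :
    (fun t => c * F t) ∈ H a R := by
  refine ⟨hF.1.const_mul c, fun A hA hAa r hr => ?_⟩
  obtain ⟨C, hC⟩ := hF.2 A hA hAa r hr
  refine ⟨‖c‖ * C, fun t ht => ?_⟩
  rw [norm_mul, mul_assoc]
  exact mul_le_mul_of_nonneg_left (hC t ht) (norm_nonneg c)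

/-- Multiplication by `t` costs an arbitrarily small increase of the exponent, hence does not
change the type. -/
lemma H.id_mul {a R : ℝ} {F : ℂ → ℂ} (hF : F ∈ H a R) : (fun t => t * F t) ∈ H a R := by
  refine ⟨differentiableOn_id.mul hF.1, fun A hA hAa r hr => ?_⟩
  obtain ⟨C, hC0, hC⟩ := H.exists_bound hF hA hAa (r := (R + r) / 2) (by linarith)
  set δ := (r - R) / 2 with hδ
  have hδ0 : 0 < δ := by rw [hδ]; linarith
  refine ⟨C / δ, fun t ht => ?_⟩
  have h1 : ‖t‖ ≤ Real.exp (δ * ‖t‖) / δ := by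
    rw [le_div_iff₀ hδ0]
    linarith [Real.add_one_le_exp (δ * ‖t‖)]
  calc ‖t * F t‖ = ‖t‖ * ‖F t‖ := norm_mul _ _
    _ ≤ Real.exp (δ * ‖t‖) / δ * (C * Real.exp ((R + r) / 2 * ‖t‖)) := by
        gcongr
        exact hC t ht
    _ = C / δ * Real.exp (r * ‖t‖) := by
        rw [show r * ‖t‖ = δ * ‖t‖ + (R + r) / 2 * ‖t‖ by rw [hδ]; ring, Real.exp_add]
        ring

/-- Cauchy's estimate on discs of fixed radius keeps the growth type of the derivative. -/
lemma H.deriv {a R : ℝ} {F : ℂ → ℂ} (hR : 0 ≤ R) (hF : F ∈ H a R) : deriv F ∈ H a R := by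
  refine ⟨hF.1.deriv (isOpen_region a), fun A hA hAa r hr => ?_⟩
  set δ := (a - A) / 2 with hδ
  have hδ0 : 0 < δ := by rw [hδ]; linarith
  obtain ⟨C, hC0, hC⟩ := H.exists_bound hF (A := A + δ) (by linarith) (by rw [hδ]; linarith) hr
  refine ⟨C * Real.exp (r * δ) / δ, fun t ht => ?_⟩
  have hsub : Metric.closedBall t δ ⊆ region (A + δ) := fun s hs => mem_region_of_dist_le ht hs
  have hdiff : DiffContOnCl ℂ F (Metric.ball t δ) := by
    refine DifferentiableOn.diffContOnCl (hF.1.mono ?_)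
    exact Metric.closure_ball_subset_closedBall.trans
      (hsub.trans (region_mono (by rw [hδ]; linarith)))
  have hbd : ∀ z ∈ Metric.sphere t δ, ‖F z‖ ≤ C * Real.exp (r * (‖t‖ + δ)) := by
    intro z hz
    refine (hC z (hsub (Metric.sphere_subset_closedBall hz))).trans ?_
    have hz' : ‖z‖ ≤ ‖t‖ + δ := by
      have := norm_le_norm_add_norm_sub t z
      rw [← dist_eq_norm, dist_comm, Metric.mem_sphere.1 hz] at this
      exact this
    have hr0 : 0 ≤ r := by linarith
    gcongr
  refine (Complex.norm_deriv_le_of_forall_mem_sphere_norm_le hδ0 hdiff hbd).trans_eq ?_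
  rw [mul_add, Real.exp_add]
  ring

/-! ### The Euler operator and the beta-kernel average -/

/-- The Euler operator `c + t d/dt`, so that `t ^ (c - 1) * eulerOp c F` is the derivative of
`t ^ c * F`. -/
noncomputable def eulerOp (c : ℂ) (F : ℂ → ℂ) (t : ℂ) : ℂ := c * F t + t * deriv F t

lemma H.eulerOp {a R : ℝ} {F : ℂ → ℂ} (hR : 0 ≤ R) (c : ℂ) (hF : F ∈ H a R) :
    eulerOp c F ∈ H a R :=
  H.add (H.const_mul c hF) (H.id_mul (H.deriv hR hF))

lemma H.continuousOn_ofReal {a R : ℝ} {F : ℂ → ℂ} (ha : 0 < a) (hF : F ∈ H a R) :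
    ContinuousOn (fun x : ℝ => F x) (Ici 0) :=
  hF.1.continuousOn.comp Complex.continuous_ofReal.continuousOn
    fun _ hx => ofReal_mem_region ha hx

lemma H.hasDerivAt {a R : ℝ} {F : ℂ → ℂ} {t : ℂ} (hF : F ∈ H a R) (ht : t ∈ region a) :
    HasDerivAt F (_root_.deriv F t) t :=
  (hF.1.differentiableAt ((isOpen_region a).mem_nhds ht)).hasDerivAt

/-- The beta-kernel average `∫₀¹ u ^ (q - 1) (1 - u) ^ (p - 1) F (u t) du`. Times
`t ^ (p + q - 1) / Γ(p)` it is the Riemann–Liouville integral of order `p` of `t ^ (q - 1) F`. -/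
noncomputable def betaOp (p q : ℂ) (F : ℂ → ℂ) (t : ℂ) : ℂ :=
  ∫ u in Ioo (0 : ℝ) 1, (u : ℂ) ^ (q - 1) * (1 - (u : ℂ)) ^ (p - 1) * F (u * t)

lemma integrableOn_betaKernel {p q : ℂ} (hp : 0 < p.re) (hq : 0 < q.re) :
    IntegrableOn (fun u : ℝ => (u : ℂ) ^ (q - 1) * (1 - (u : ℂ)) ^ (p - 1)) (Ioo 0 1) := by
  have h := Complex.betaIntegral_convergent hq hp
  rwa [intervalIntegrable_iff_integrableOn_Ioo_of_le zero_le_one] at h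

/-- The points `u t`, `0 < u < 1`, stay in the region of `t`, so the values of `F` there obey the
growth bound at `t`. -/
lemma norm_comp_ofReal_mul_le {A r C u : ℝ} {F : ℂ → ℂ} {t : ℂ} (hr : 0 ≤ r) (hC0 : 0 ≤ C)
    (hC : ∀ t ∈ region A, ‖F t‖ ≤ C * Real.exp (r * ‖t‖)) (ht : t ∈ region A)
    (hu : u ∈ Ioo (0 : ℝ) 1) : ‖F (u * t)‖ ≤ C * Real.exp (r * ‖t‖) := by
  refine (hC _ (ofReal_mul_mem_region ht hu.1 hu.2.le)).trans ?_
  have : ‖(u : ℂ) * t‖ ≤ ‖t‖ := by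
    rw [norm_mul, Complex.norm_real, Real.norm_of_nonneg hu.1.le]
    exact mul_le_of_le_one_left (norm_nonneg t) hu.2.le
  gcongr

lemma continuousOn_comp_ofReal_mul {A : ℝ} {F : ℂ → ℂ} (hF : ContinuousOn F (region A)) {t : ℂ}
    (ht : t ∈ region A) : ContinuousOn (fun u : ℝ => F (u * t)) (Ioo 0 1) :=
  hF.comp (by fun_prop) fun _ hu => ofReal_mul_mem_region ht hu.1 hu.2.le

lemma H.betaOp {a R : ℝ} {F : ℂ → ℂ} {p q : ℂ} (hR : 0 ≤ R) (hp : 0 < p.re) (hq : 0 < q.re)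
    (hF : F ∈ H a R) : betaOp p q F ∈ H a R := by
  have hk := integrableOn_betaKernel hp hq
  set k : ℝ → ℂ := fun u => (u : ℂ) ^ (q - 1) * (1 - (u : ℂ)) ^ (p - 1) with hkdef
  have hmeas : ∀ t ∈ region a, AEStronglyMeasurable (fun u : ℝ => k u * F (u * t))
      (volume.restrict (Ioo 0 1)) := fun t ht =>
    hk.aestronglyMeasurable.mul
      ((continuousOn_comp_ofReal_mul hF.1.continuousOn ht).aestronglyMeasurable measurableSet_Ioo)
  refine ⟨fun t ht => ?_, fun A hA hAa r hr => ?_⟩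
  · obtain ⟨A, hA, hAa, htA⟩ := exists_mem_region_lt ht
    obtain ⟨C, hC0, hC⟩ := H.exists_bound hF hA hAa (r := R + 1) (by linarith)
    obtain ⟨D, hD0, hD⟩ := H.exists_bound (H.deriv hR hF) hA hAa (r := R + 1) (by linarith)
    set s := region A ∩ Metric.ball t 1 with hs
    have hsn : s ∈ 𝓝 t := inter_mem ((isOpen_region A).mem_nhds htA) (Metric.ball_mem_nhds t one_pos)
    have key := hasDerivAt_integral_of_dominated_loc_of_deriv_le
      (μ := volume.restrict (Ioo (0 : ℝ) 1)) (F := fun t (u : ℝ) => k u * F (u * t))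
      (F' := fun t (u : ℝ) => k u * (_root_.deriv F (u * t) * u))
      (bound := fun u => ‖k u‖ * (D * Real.exp ((R + 1) * (‖t‖ + 1)))) hsn ?_ ?_ ?_ ?_ ?_ ?_
    · exact key.2.differentiableAt.differentiableWithinAt
    · filter_upwards [(isOpen_region a).mem_nhds ht] with z hz using hmeas z hz
    · refine Integrable.mono' (hk.norm.mul_const (C * Real.exp ((R + 1) * ‖t‖))) (hmeas t ht) ?_
      filter_upwards [ae_restrict_mem measurableSet_Ioo] with u hu
      rw [norm_mul]
      gcongr
      exact norm_comp_ofReal_mul_le (by linarith) hC0 hC htA hu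
    · refine hk.aestronglyMeasurable.mul (AEStronglyMeasurable.mul ?_ (by fun_prop))
      exact (continuousOn_comp_ofReal_mul (H.deriv hR hF).1.continuousOn ht).aestronglyMeasurable
        measurableSet_Ioo
    · filter_upwards [ae_restrict_mem measurableSet_Ioo] with u hu z hz
      have hz' : ‖z‖ ≤ ‖t‖ + 1 := by
        have h1 := norm_le_norm_add_norm_sub t z
        have h2 := Metric.mem_ball.1 hz.2
        rw [dist_comm, dist_eq_norm] at h2
        linarith
      have hu1 : ‖(u : ℂ)‖ ≤ 1 := by
        rw [Complex.norm_real, Real.norm_of_nonneg hu.1.le]; exact hu.2.le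
      have h3 : ‖_root_.deriv F (u * z)‖ ≤ D * Real.exp ((R + 1) * (‖t‖ + 1)) := by
        refine (norm_comp_ofReal_mul_le (by linarith) hD0 hD hz.1 hu).trans ?_
        gcongr
      rw [norm_mul, norm_mul (_root_.deriv F _)]
      refine mul_le_mul_of_nonneg_left ?_ (norm_nonneg _)
      exact (mul_le_of_le_one_right (norm_nonneg _) hu1).trans h3
    · exact hk.norm.mul_const _
    · filter_upwards [ae_restrict_mem measurableSet_Ioo] with u hu z hz
      have hmem : (u : ℂ) * z ∈ region a :=
        region_mono hAa.le (ofReal_mul_mem_region hz.1 hu.1 hu.2.le)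
      have h := (H.hasDerivAt hF hmem).comp z ((hasDerivAt_id z).const_mul (u : ℂ))
      simpa using h.const_mul (k u)
  · obtain ⟨C, hC0, hC⟩ := H.exists_bound hF hA hAa hr
    refine ⟨(∫ u in Ioo (0 : ℝ) 1, ‖k u‖) * C, fun t ht => ?_⟩
    rw [mul_assoc, ← integral_mul_const]
    refine norm_integral_le_of_norm_le (hk.norm.mul_const _) ?_
    filter_upwards [ae_restrict_mem measurableSet_Ioo] with u hu
    rw [norm_mul]
    gcongr
    exact norm_comp_ofReal_mul_le (by linarith) hC0 hC ht hu

/-! ### Convergence of the Laplace integrals -/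

lemma one_mem_H {a : ℝ} : (fun _ => 1 : ℂ → ℂ) ∈ H a 0 := by
  refine ⟨differentiableOn_const _, fun A _ _ r hr => ⟨1, fun t _ => ?_⟩⟩
  rw [norm_one, one_mul]
  exact Real.one_le_exp (by positivity)

lemma norm_exp_neg_mul_ofReal (ζ : ℂ) (t : ℝ) :
    ‖Complex.exp (-ζ * t)‖ = Real.exp (-ζ.re * t) := by
  simp [Complex.norm_exp]

lemma continuousOn_cpow_ofReal (q : ℂ) : ContinuousOn (fun t : ℝ => (t : ℂ) ^ q) (Ioi 0) :=
  fun t ht =>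
    (Complex.continuousAt_ofReal_cpow_const t q (Or.inr (ne_of_gt ht))).continuousWithinAt

lemma continuousOn_laplace_integrand {a R : ℝ} {F : ℂ → ℂ} (ha : 0 < a) (hF : F ∈ H a R)
    (q ζ : ℂ) :
    ContinuousOn (fun t : ℝ => Complex.exp (-ζ * t) * ((t : ℂ) ^ q * F t)) (Ioi 0) :=
  ContinuousOn.mul (by fun_prop) ((continuousOn_cpow_ofReal q).mul
    ((H.continuousOn_ofReal ha hF).mono Ioi_subset_Ici_self))

lemma exists_norm_laplace_integrand_le {a R : ℝ} {F : ℂ → ℂ} (ha : 0 < a) (hF : F ∈ H a R)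
    {ζ : ℂ} (hζ : R < ζ.re) :
    ∃ C b : ℝ, 0 < b ∧ ∀ q : ℂ, ∀ t : ℝ, 0 < t →
      ‖Complex.exp (-ζ * t) * ((t : ℂ) ^ q * F t)‖ ≤ C * (t ^ q.re * Real.exp (-b * t)) := by
  obtain ⟨C, hC0, hC⟩ := H.exists_bound hF (half_pos ha) (half_lt_self ha)
    (r := (R + ζ.re) / 2) (by linarith)
  refine ⟨C, (ζ.re - R) / 2, by linarith, fun q t ht => ?_⟩
  have h1 := hC t (ofReal_mem_region (half_pos ha) ht.le)
  rw [Complex.norm_real, Real.norm_of_nonneg ht.le] at h1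
  rw [norm_mul, norm_mul, norm_exp_neg_mul_ofReal, Complex.norm_cpow_eq_rpow_re_of_pos ht]
  calc Real.exp (-ζ.re * t) * (t ^ q.re * ‖F t‖)
      ≤ Real.exp (-ζ.re * t) * (t ^ q.re * (C * Real.exp ((R + ζ.re) / 2 * t))) := by gcongr
    _ = C * (t ^ q.re * Real.exp (-((ζ.re - R) / 2) * t)) := by
        rw [show -((ζ.re - R) / 2) * t = -ζ.re * t + (R + ζ.re) / 2 * t by ring, Real.exp_add]
        ring

lemma integrableOn_rpow_mul_exp {s b : ℝ} (hs : -1 < s) (hb : 0 < b) :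
    IntegrableOn (fun t : ℝ => t ^ s * Real.exp (-b * t)) (Ioi 0) := by
  simpa using integrableOn_rpow_mul_exp_neg_mul_rpow hs one_pos hb

lemma integrableOn_laplace {a R : ℝ} {F : ℂ → ℂ} (ha : 0 < a) (hF : F ∈ H a R) {q ζ : ℂ}
    (hq : -1 < q.re) (hζ : R < ζ.re) :
    IntegrableOn (fun t : ℝ => Complex.exp (-ζ * t) * ((t : ℂ) ^ q * F t)) (Ioi 0) := by
  obtain ⟨C, b, hb, hC⟩ := exists_norm_laplace_integrand_le ha hF hζ
  refine Integrable.mono' ((integrableOn_rpow_mul_exp hq hb).const_mul C)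
    ((continuousOn_laplace_integrand ha hF q ζ).aestronglyMeasurable measurableSet_Ioi) ?_
  filter_upwards [ae_restrict_mem measurableSet_Ioi] with t ht using hC q t ht

/-! ### Laplace transforms of the two operators -/

/-- Euler's integral `∫₀^∞ e^{-ζ t} t ^ (p - 1) dt = Γ(p) ζ ^ (-p)` for complex `ζ`, by analytic
continuation from the positive axis. -/
lemma integral_exp_mul_cpow {p ζ : ℂ} (hp : 0 < p.re) (hζ : 0 < ζ.re) :
    ∫ t in Ioi (0 : ℝ), Complex.exp (-ζ * t) * (t : ℂ) ^ (p - 1) =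
      ζ ^ (-p) * Complex.Gamma p := by
  have hp1 : -1 < (p - 1).re := by simpa using hp
  set U : Set ℂ := {z | 0 < z.re} with hU
  have hUo : IsOpen U := isOpen_lt continuous_const Complex.continuous_re
  have hUc : IsPreconnected U := (convex_halfSpace_re_gt 0).isPreconnected
  have hint : ∀ (q : ℂ), -1 < q.re → ∀ z ∈ U,
      IntegrableOn (fun t : ℝ => Complex.exp (-z * t) * (t : ℂ) ^ q) (Ioi 0) := by
    intro q hq z hz
    simpa using integrableOn_laplace one_pos one_mem_H hq hz
  have hd1 : DifferentiableOn ℂ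
      (fun z => ∫ t in Ioi (0 : ℝ), Complex.exp (-z * t) * (t : ℂ) ^ (p - 1)) U := by
    intro z hz
    have hz0 : 0 < z.re := hz
    set s : Set ℂ := {w | z.re / 2 < w.re} with hs
    have hsn : s ∈ 𝓝 z := (isOpen_lt continuous_const Complex.continuous_re).mem_nhds
      (show z.re / 2 < z.re by linarith)
    have key := hasDerivAt_integral_of_dominated_loc_of_deriv_le
      (μ := volume.restrict (Ioi (0 : ℝ)))
      (F := fun z (t : ℝ) => Complex.exp (-z * t) * (t : ℂ) ^ (p - 1))
      (F' := fun z (t : ℝ) => Complex.exp (-z * t) * (-(t : ℂ)) * (t : ℂ) ^ (p - 1))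
      (bound := fun t => t ^ p.re * Real.exp (-(z.re / 2) * t)) hsn ?_ (hint _ hp1 z hz) ?_ ?_
      (integrableOn_rpow_mul_exp (by linarith) (by linarith)) ?_
    · exact key.2.differentiableAt.differentiableWithinAt
    · filter_upwards [hUo.mem_nhds hz] with w hw using (hint _ hp1 w hw).aestronglyMeasurable
    · exact (ContinuousOn.mul (by fun_prop) (continuousOn_cpow_ofReal _)).aestronglyMeasurable
        measurableSet_Ioi
    · filter_upwards [ae_restrict_mem measurableSet_Ioi] with t ht w hw
      have ht0 : 0 < t := ht
      have hw0 : z.re / 2 < w.re := hw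
      rw [norm_mul, norm_mul, norm_exp_neg_mul_ofReal, norm_neg, Complex.norm_real,
        Real.norm_of_nonneg ht0.le, Complex.norm_cpow_eq_rpow_re_of_pos ht0, mul_assoc,
        show t * t ^ (p - 1).re = t ^ p.re by
          rw [Complex.sub_re, Complex.one_re, Real.rpow_sub_one ht0.ne']; field_simp, mul_comm]
      gcongr
    · filter_upwards with t w _
      have h := ((hasDerivAt_id w).neg.mul_const (t : ℂ)).cexp.mul_const ((t : ℂ) ^ (p - 1))
      simpa using h
  have hd2 : DifferentiableOn ℂ (fun z => z ^ (-p) * Complex.Gamma p) U := fun z hz =>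
    ((differentiableAt_id.cpow_const (Or.inl hz)).mul_const _).differentiableWithinAt
  refine (hd1.analyticOnNhd hUo).eqOn_of_preconnected_of_frequently_eq (hd2.analyticOnNhd hUo) hUc
    (z₀ := 1) (by simp [hU]) ?_ hζ
  have hreal : ∀ x : ℝ, 0 < x →
      ∫ t in Ioi (0 : ℝ), Complex.exp (-(x : ℂ) * t) * (t : ℂ) ^ (p - 1) =
        (x : ℂ) ^ (-p) * Complex.Gamma p := by
    intro x hx
    rw [Complex.cpow_neg, ← Complex.inv_cpow _ _
      (by rw [Complex.arg_ofReal_of_nonneg hx.le]; exact Real.pi_pos.ne), ← one_div,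
      ← Complex.integral_cpow_mul_exp_neg_mul_Ioi hp hx]
    simp only [neg_mul, mul_comm (Complex.exp _)]
  have htend : Tendsto (fun n : ℕ => (((1 + 1 / ((n : ℝ) + 1) : ℝ)) : ℂ)) atTop (𝓝[≠] 1) := by
    refine tendsto_nhdsWithin_iff.2 ⟨?_, Eventually.of_forall fun n => ?_⟩
    · have h := (Complex.continuous_ofReal.tendsto (1 + 0)).comp
        ((tendsto_one_div_add_atTop_nhds_zero_nat (𝕜 := ℝ)).const_add 1)
      simpa [Function.comp_def] using h
    · have : (0 : ℝ) < 1 / ((n : ℝ) + 1) := by positivity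
      simp only [mem_compl_iff, mem_singleton_iff]
      rw [← Complex.ofReal_one, Complex.ofReal_inj]
      linarith
  exact htend.frequently (Frequently.of_forall fun n => hreal _ (by positivity))

/-- On the positive axis, `t ^ (p + q - 1) * betaOp p q F` is the convolution of `t ^ (q - 1) F`
with `t ^ (p - 1)`. -/
lemma cpow_mul_betaOp (p q : ℂ) (F : ℂ → ℂ) {t : ℝ} (ht : 0 < t) :
    (t : ℂ) ^ (p + q - 1) * betaOp p q F t =
      ∫ s in (0 : ℝ)..t, (s : ℂ) ^ (q - 1) * F s * ((t - s : ℝ) : ℂ) ^ (p - 1) := by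
  have ht' : (t : ℂ) ≠ 0 := Complex.ofReal_ne_zero.mpr ht.ne'
  have h := intervalIntegral.smul_integral_comp_mul_left (a := 0) (b := 1)
    (f := fun s : ℝ => (s : ℂ) ^ (q - 1) * F s * ((t - s : ℝ) : ℂ) ^ (p - 1)) t
  rw [mul_zero, mul_one, Complex.real_smul] at h
  rw [← h, betaOp, ← integral_Ioc_eq_integral_Ioo, ← intervalIntegral.integral_of_le zero_le_one,
    show p + q - 1 = 1 + (p - 1) + (q - 1) by ring, Complex.cpow_add _ _ ht',
    Complex.cpow_add _ _ ht', Complex.cpow_one, mul_assoc, mul_assoc,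
    ← intervalIntegral.integral_const_mul, ← intervalIntegral.integral_const_mul]
  congr 1
  refine intervalIntegral.integral_congr fun u hu => ?_
  rw [uIcc_of_le zero_le_one] at hu
  have h1 : ((t : ℂ) * u) ^ (q - 1) = (t : ℂ) ^ (q - 1) * (u : ℂ) ^ (q - 1) :=
    Complex.mul_cpow_ofReal_nonneg ht.le hu.1 _
  have h2 : ((t - t * u : ℝ) : ℂ) ^ (p - 1) = (t : ℂ) ^ (p - 1) * (1 - (u : ℂ)) ^ (p - 1) := by
    rw [show t - t * u = t * (1 - u) by ring, Complex.ofReal_mul,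
      Complex.mul_cpow_ofReal_nonneg ht.le (sub_nonneg.2 hu.2), Complex.ofReal_sub,
      Complex.ofReal_one]
  simp only [h2, Complex.ofReal_mul, h1, mul_comm (u : ℂ) (t : ℂ)]
  ring

/-- The Laplace transform turns the convolution in `cpow_mul_betaOp` into a product. -/
lemma integral_laplace_betaOp {a R : ℝ} {F : ℂ → ℂ} {p q ζ : ℂ} (ha : 0 < a) (hR : 0 ≤ R)
    (hF : F ∈ H a R) (hp : 0 < p.re) (hq : 0 < q.re) (hζ : R < ζ.re) :
    ∫ t in Ioi (0 : ℝ), Complex.exp (-ζ * t) * ((t : ℂ) ^ (p + q - 1) * betaOp p q F t) =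
      Complex.Gamma p * (ζ ^ (-p) *
        ∫ t in Ioi (0 : ℝ), Complex.exp (-ζ * t) * ((t : ℂ) ^ (q - 1) * F t)) := by
  have hζ0 : 0 < ζ.re := hR.trans_lt hζ
  have hf := integrableOn_laplace ha hF (q := q - 1) (by simpa using hq) hζ
  have hg : IntegrableOn (fun t : ℝ => Complex.exp (-ζ * t) * (t : ℂ) ^ (p - 1)) (Ioi 0) := by
    simpa using integrableOn_laplace one_pos one_mem_H (q := p - 1) (by simpa using hp) hζ0
  have hconv := integral_posConvolution hf hg (ContinuousLinearMap.mul ℝ ℂ)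
  simp only [ContinuousLinearMap.mul_apply'] at hconv
  rw [integral_exp_mul_cpow hp hζ0] at hconv
  rw [show ∀ x y z : ℂ, x * (y * z) = z * (y * x) by intros; ring, ← hconv]
  refine setIntegral_congr_fun measurableSet_Ioi fun t ht => ?_
  rw [cpow_mul_betaOp p q F ht, ← intervalIntegral.integral_const_mul]
  refine intervalIntegral.integral_congr fun s _ => ?_
  have : Complex.exp (-ζ * t) =
      Complex.exp (-ζ * s) * Complex.exp (-ζ * ((t - s : ℝ) : ℂ)) := by
    rw [← Complex.exp_add]
    push_cast
    ring_nf
  simp only [this]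
  ring

/-- Integration by parts. -/
lemma integral_laplace_eulerOp {a R : ℝ} {F : ℂ → ℂ} {c ζ : ℂ} (ha : 0 < a) (hR : 0 ≤ R)
    (hF : F ∈ H a R) (hc : 0 < c.re) (hζ : R < ζ.re) :
    ∫ t in Ioi (0 : ℝ), Complex.exp (-ζ * t) * ((t : ℂ) ^ (c - 1) * eulerOp c F t) =
      ζ * ∫ t in Ioi (0 : ℝ), Complex.exp (-ζ * t) * ((t : ℂ) ^ c * F t) := by
  have hc0 : c ≠ 0 := by rintro rfl; simp at hc
  set P : ℝ → ℂ := fun t => Complex.exp (-ζ * t) * ((t : ℂ) ^ c * F t) with hP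
  have hi1 : IntegrableOn
      (fun t : ℝ => Complex.exp (-ζ * t) * ((t : ℂ) ^ (c - 1) * eulerOp c F t)) (Ioi 0) :=
    integrableOn_laplace ha (H.eulerOp hR c hF) (by simpa using hc) hζ
  have hi2 : IntegrableOn P (Ioi 0) := integrableOn_laplace ha hF (by linarith) hζ
  have hcont : ContinuousWithinAt P (Ici 0) 0 := by
    refine ContinuousWithinAt.mul (by fun_prop) (ContinuousWithinAt.mul ?_
      (H.continuousOn_ofReal ha hF 0 self_mem_Ici))
    exact (Complex.continuousAt_ofReal_cpow_const 0 c (Or.inl hc)).continuousWithinAt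
  have hderiv : ∀ t ∈ Ioi (0 : ℝ), HasDerivAt P
      (Complex.exp (-ζ * t) * ((t : ℂ) ^ (c - 1) * eulerOp c F t) - ζ * P t) t := by
    intro t ht
    have ht0 : (t : ℂ) ≠ 0 := Complex.ofReal_ne_zero.mpr (ne_of_gt ht)
    have h1 : HasDerivAt (fun z : ℂ => Complex.exp (-ζ * z)) (Complex.exp (-ζ * t) * (-ζ)) t := by
      simpa using ((hasDerivAt_id (t : ℂ)).const_mul (-ζ)).cexp
    have h2 : HasDerivAt (fun z : ℂ => z ^ c) (c * (t : ℂ) ^ (c - 1)) t := by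
      simpa using (hasDerivAt_id (t : ℂ)).cpow_const (c := c) (Or.inl (by simpa using ht))
    have h3 := H.hasDerivAt hF (ofReal_mem_region ha (le_of_lt ht))
    refine ((h1.mul (h2.mul h3)).comp_ofReal).congr_deriv ?_
    have h4 : (t : ℂ) ^ c = (t : ℂ) ^ (c - 1) * t := by
      rw [Complex.cpow_sub _ _ ht0, Complex.cpow_one, div_mul_cancel₀ _ ht0]
    simp only [hP, eulerOp, h4, Pi.mul_apply]
    ring
  have hlim : Tendsto P atTop (𝓝 0) := by
    obtain ⟨C, b, hb, hC⟩ := exists_norm_laplace_integrand_le ha hF hζ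
    have h := (tendsto_rpow_mul_exp_neg_mul_atTop_nhds_zero c.re b hb).const_mul C
    rw [mul_zero] at h
    refine squeeze_zero_norm' ?_ h
    filter_upwards [eventually_gt_atTop 0] with t ht using hC c t ht
  have h := integral_Ioi_of_hasDerivAt_of_tendsto hcont hderiv (hi1.sub (hi2.const_mul ζ)) hlim
  rw [integral_sub hi1 (hi2.const_mul ζ), integral_const_mul] at h
  have hP0 : P 0 = 0 := by simp [hP, hc0]
  rw [hP0, sub_zero] at h
  exact sub_eq_zero.1 h

/-! ### Injectivity of the Laplace transform -/

/-- A continuous function on the half-line vanishes if its Laplace integral vanishes on one vertical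
line of absolute convergence: there it is the Fourier transform of `exp (-σ t) f t`, to which
Fourier inversion at the points of continuity applies. -/
lemma eq_zero_of_laplace_eq_zero {f : ℝ → ℂ} {σ : ℝ} (hf : ContinuousOn f (Ioi 0))
    (hint : IntegrableOn (fun t : ℝ => Complex.exp (-(σ : ℂ) * t) * f t) (Ioi 0))
    (h : ∀ ζ : ℂ, ζ.re = σ → ∫ t in Ioi (0 : ℝ), Complex.exp (-ζ * t) * f t = 0)
    {t : ℝ} (ht : 0 < t) : f t = 0 := by
  set k : ℝ → ℂ := fun t => Complex.exp (-(σ : ℂ) * t) * f t with hk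
  have hg : Integrable ((Ioi (0 : ℝ)).indicator k) :=
    (integrable_indicator_iff measurableSet_Ioi).2 hint
  have hF : FourierTransform.fourier ((Ioi (0 : ℝ)).indicator k) = fun _ => (0 : ℂ) := by
    funext w
    rw [Real.fourier_real_eq_integral_exp_smul,
      ← h ((σ : ℂ) + (2 * Real.pi * w : ℝ) * Complex.I) (by simp),
      ← integral_indicator measurableSet_Ioi]
    congr 1
    funext v
    by_cases hv : v ∈ Ioi (0 : ℝ)
    · rw [indicator_of_mem hv, indicator_of_mem hv, hk, smul_eq_mul, ← mul_assoc,
        ← Complex.exp_add]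
      congr 2
      push_cast
      ring
    · rw [indicator_of_notMem hv, indicator_of_notMem hv, smul_zero]
  have hev : (Ioi (0 : ℝ)).indicator k =ᶠ[𝓝 t] k := by
    filter_upwards [Ioi_mem_nhds ht] with s hs using indicator_of_mem hs k
  have hkc : ContinuousAt k t :=
    ContinuousAt.mul (by fun_prop) (hf.continuousAt (Ioi_mem_nhds ht))
  have hinv := hg.fourierInv_fourier_eq (by rw [hF]; exact integrable_zero _ _ _)
    (hkc.congr hev.symm)
  rw [hF, hev.eq_of_nhds, Real.fourierInv_eq] at hinv
  simp only [smul_zero, integral_zero] at hinv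
  exact (mul_eq_zero.1 hinv.symm).resolve_left (Complex.exp_ne_zero _)

lemma laplace_eq_laplaceAlpha_zero : laplace = laplaceAlpha 0 := by
  funext F ζ
  simp [laplace, laplaceAlpha]

lemma laplaceAlpha_injective {α : ℂ} (hα : -1 < α.re) {a b R S : ℝ} {F G : ℂ → ℂ} (ha : 0 < a)
    (hb : 0 < b) (hF : F ∈ H a R) (hG : G ∈ H b S)
    (h : EqHalfPlane (laplaceAlpha α F) (laplaceAlpha α G)) {t : ℝ} (ht : 0 < t) :
    F t = G t := by
  obtain ⟨ρ, hρ⟩ := h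
  obtain ⟨σ, hσ⟩ := exists_gt (max (max ρ 0) (max R S))
  simp only [max_lt_iff] at hσ
  obtain ⟨⟨hσρ, hσ0⟩, hσR, hσS⟩ := hσ
  have hi1 : ∀ ζ : ℂ, ζ.re = σ → _ := fun ζ hζ =>
    integrableOn_laplace ha hF (ζ := ζ) hα (by rw [hζ]; exact hσR)
  have hi2 : ∀ ζ : ℂ, ζ.re = σ → _ := fun ζ hζ =>
    integrableOn_laplace hb hG (ζ := ζ) hα (by rw [hζ]; exact hσS)
  have hsub : ∀ ζ : ℂ, (fun t : ℝ => Complex.exp (-ζ * t) * ((t : ℂ) ^ α * (F t - G t))) =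
      fun t : ℝ => Complex.exp (-ζ * t) * ((t : ℂ) ^ α * F t) -
        Complex.exp (-ζ * t) * ((t : ℂ) ^ α * G t) := fun ζ => by
    funext t
    ring
  have h0 : (t : ℂ) ^ α * (F t - G t) = 0 := by
    refine eq_zero_of_laplace_eq_zero (f := fun t : ℝ => (t : ℂ) ^ α * (F t - G t)) (σ := σ)
      ?_ ?_ (fun ζ hζ => ?_) ht
    · exact (continuousOn_cpow_ofReal α).mul
        (((H.continuousOn_ofReal ha hF).sub (H.continuousOn_ofReal hb hG)).mono
          Ioi_subset_Ici_self)
    · rw [hsub]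
      exact (hi1 _ (Complex.ofReal_re σ)).sub (hi2 _ (Complex.ofReal_re σ))
    · have hζ0 : ζ ≠ 0 := by
        rintro rfl
        rw [Complex.zero_re] at hζ
        exact hσ0.ne hζ
      have h1 := hρ ζ (by rw [hζ]; exact hσρ)
      simp only [laplaceAlpha, laplace] at h1
      have h2 := mul_left_cancel₀ hζ0 (mul_left_cancel₀ (by simp [Complex.cpow_eq_zero_iff, hζ0]) h1)
      rw [hsub, integral_sub (hi1 ζ hζ) (hi2 ζ hζ), h2, sub_self]
  have ht0 : (t : ℂ) ≠ 0 := Complex.ofReal_ne_zero.mpr ht.ne'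
  exact sub_eq_zero.1 ((mul_eq_zero.1 h0).resolve_left (by simp [Complex.cpow_eq_zero_iff, ht0]))

/-- Any preimage `G` in the union of the `H b ρ` computes the inverse operator on the positive
axis. -/
lemma invOp_laplaceAlpha_eq {α : ℂ} (hα : -1 < α.re) {b ρ : ℝ} {G P : ℂ → ℂ} (hb : 0 < b)
    (hρ : 0 ≤ ρ) (hG : G ∈ H b ρ) (h : EqHalfPlane (laplaceAlpha α G) P) {t : ℝ} (ht : 0 < t) :
    invOp (laplaceAlpha α) P t = G t := by
  have hex : ∃ G : ℂ → ℂ, (∃ b ρ : ℝ, 0 < b ∧ 0 ≤ ρ ∧ G ∈ H b ρ ∧ (t : ℂ) ∈ region b) ∧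
      EqHalfPlane (laplaceAlpha α G) P :=
    ⟨G, ⟨b, ρ, hb, hρ, hG, ofReal_mem_region hb ht.le⟩, h⟩
  rw [invOp, dif_pos hex]
  obtain ⟨⟨c, τ, hc, -, hK, -⟩, κ, hκ⟩ := hex.choose_spec
  obtain ⟨κ', hκ'⟩ := h
  refine laplaceAlpha_injective hα hc hb hK hG ⟨max κ κ', fun ζ hζ => ?_⟩ ht
  rw [hκ ζ ((le_max_left _ _).trans_lt hζ), hκ' ζ ((le_max_right _ _).trans_lt hζ)]

/-! ### Fractional integrals and derivatives in the growth class -/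

lemma ne_zero_of_lt_re {R : ℝ} {ζ : ℂ} (hR : 0 ≤ R) (hζ : R < ζ.re) : ζ ≠ 0 := by
  rintro rfl
  exact absurd hζ (by simpa using hR)

/-- The fractional integral of order `α` of `F`, divided by `t ^ α`. Integrating to order `α + 1`
and differentiating once covers all `Re α > -1`. -/
lemma exists_fracI {a R : ℝ} {α : ℂ} {F : ℂ → ℂ} (ha : 0 < a) (hR : 0 ≤ R) (hα : -1 < α.re)
    (hF : F ∈ H a R) :
    ∃ G ∈ H a R, ∀ ζ : ℂ, R < ζ.re →
      ζ ^ α * ∫ t in Ioi (0 : ℝ), Complex.exp (-ζ * t) * ((t : ℂ) ^ α * G t) =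
        ∫ t in Ioi (0 : ℝ), Complex.exp (-ζ * t) * F t := by
  have hp : 0 < (α + 1).re := by rw [Complex.add_re, Complex.one_re]; linarith
  have h1 : (0 : ℝ) < (1 : ℂ).re := by simp
  have hK := H.betaOp hR hp h1 hF
  have hΓ := Complex.Gamma_ne_zero_of_re_pos hp
  refine ⟨_, H.const_mul (Complex.Gamma (α + 1))⁻¹ (H.eulerOp hR (α + 1) hK), fun ζ hζ => ?_⟩
  have hζ0 := ne_zero_of_lt_re hR hζ
  have e1 := integral_laplace_eulerOp ha hR hK hp hζ
  have e2 := integral_laplace_betaOp ha hR hF hp h1 hζ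
  simp only [add_sub_cancel_right, sub_self, Complex.cpow_zero, one_mul] at e1 e2
  have e3 : ∫ t in Ioi (0 : ℝ), Complex.exp (-ζ * t) * ((t : ℂ) ^ α *
      ((Complex.Gamma (α + 1))⁻¹ * eulerOp (α + 1) (betaOp (α + 1) 1 F) t)) =
      (Complex.Gamma (α + 1))⁻¹ * ∫ t in Ioi (0 : ℝ), Complex.exp (-ζ * t) *
        ((t : ℂ) ^ α * eulerOp (α + 1) (betaOp (α + 1) 1 F) t) := by
    rw [← integral_const_mul]
    congr 1
    funext t
    ring
  rw [e3, e1, e2, Complex.cpow_neg, Complex.cpow_add _ _ hζ0, Complex.cpow_one]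
  have hζα : ζ ^ α ≠ 0 := by simp [Complex.cpow_eq_zero_iff, hζ0]
  field_simp

/-- The fractional derivative of order `α` of `t ^ α F`. For `|Re α| < 1` it is the derivative of a
fractional integral of order `1 - α`. -/
lemma exists_fracD_of_re_lt_one {a R : ℝ} {α : ℂ} {F : ℂ → ℂ} (ha : 0 < a) (hR : 0 ≤ R)
    (hα : -1 < α.re) (hα1 : α.re < 1) (hF : F ∈ H a R) :
    ∃ G ∈ H a R, ∀ ζ : ℂ, R < ζ.re →
      ∫ t in Ioi (0 : ℝ), Complex.exp (-ζ * t) * G t =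
        ζ ^ α * ∫ t in Ioi (0 : ℝ), Complex.exp (-ζ * t) * ((t : ℂ) ^ α * F t) := by
  have hp : 0 < (1 - α).re := by rw [Complex.sub_re, Complex.one_re]; linarith
  have hq : 0 < (α + 1).re := by rw [Complex.add_re, Complex.one_re]; linarith
  have h1 : (0 : ℝ) < (1 : ℂ).re := by simp
  have hK := H.betaOp hR hp hq hF
  have hΓ := Complex.Gamma_ne_zero_of_re_pos hp
  refine ⟨_, H.const_mul (Complex.Gamma (1 - α))⁻¹ (H.eulerOp hR 1 hK), fun ζ hζ => ?_⟩
  have hζ0 := ne_zero_of_lt_re hR hζ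
  have e1 := integral_laplace_eulerOp ha hR hK h1 hζ
  have e2 := integral_laplace_betaOp ha hR hF hp hq hζ
  rw [show 1 - α + (α + 1) - 1 = 1 by ring, show -(1 - α) = α - 1 by ring,
    Complex.cpow_sub _ _ hζ0, Complex.cpow_one] at e2
  simp only [add_sub_cancel_right, sub_self, Complex.cpow_zero, one_mul] at e1 e2
  have e3 : ∫ t in Ioi (0 : ℝ), Complex.exp (-ζ * t) *
      ((Complex.Gamma (1 - α))⁻¹ * eulerOp 1 (betaOp (1 - α) (α + 1) F) t) =
      (Complex.Gamma (1 - α))⁻¹ * ∫ t in Ioi (0 : ℝ), Complex.exp (-ζ * t) *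
        eulerOp 1 (betaOp (1 - α) (α + 1) F) t := by
    rw [← integral_const_mul]
    congr 1
    funext t
    ring
  rw [e3, e1, e2]
  field_simp

/-- Larger orders reduce to smaller ones, since `t ^ (α - 1) * eulerOp α F` is the derivative of
`t ^ α F`. -/
lemma exists_fracD {a R : ℝ} {α : ℂ} {F : ℂ → ℂ} (ha : 0 < a) (hR : 0 ≤ R) (hα : -1 < α.re)
    (hF : F ∈ H a R) :
    ∃ G ∈ H a R, ∀ ζ : ℂ, R < ζ.re →
      ∫ t in Ioi (0 : ℝ), Complex.exp (-ζ * t) * G t =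
        ζ ^ α * ∫ t in Ioi (0 : ℝ), Complex.exp (-ζ * t) * ((t : ℂ) ^ α * F t) := by
  obtain ⟨n, hn⟩ := exists_nat_gt α.re
  induction n generalizing α F with
  | zero => exact exists_fracD_of_re_lt_one ha hR hα (by push_cast at hn; linarith) hF
  | succ n ih =>
    rcases lt_or_ge α.re 1 with h | h
    · exact exists_fracD_of_re_lt_one ha hR hα h hF
    · obtain ⟨G, hG, hGL⟩ := ih (α := α - 1) (F := eulerOp α F)
        (by rw [Complex.sub_re, Complex.one_re]; linarith) (H.eulerOp hR α hF)
        (by rw [Complex.sub_re, Complex.one_re]; push_cast at hn; linarith)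
      refine ⟨G, hG, fun ζ hζ => ?_⟩
      have hζ0 := ne_zero_of_lt_re hR hζ
      rw [hGL ζ hζ, integral_laplace_eulerOp ha hR hF (by linarith) hζ, Complex.cpow_sub _ _ hζ0,
        Complex.cpow_one, ← mul_assoc, div_mul_cancel₀ _ hζ0]

end FracCalc

theorem theorem4 (a R : ℝ) (ha : 0 < a) (hR : 0 ≤ R) (α : ℂ) (hα : -1 < α.re)
    (F : ℂ → ℂ) (hF : F ∈ FracCalc.H a R) (ζ : ℂ) (hζ : R < ζ.re) :
    (IntegrableOn (fun t : ℝ => Complex.exp (-ζ * t) * ((t : ℂ) ^ α * F t)) (Ioi 0) ∧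
      IntegrableOn (fun t : ℝ => Complex.exp (-ζ * t) * FracCalc.fracD α F t) (Ioi 0) ∧
      ζ * ∫ t in Ioi (0 : ℝ), Complex.exp (-ζ * t) * ((t : ℂ) ^ α * F t) =
        ζ ^ (1 - α) * ∫ t in Ioi (0 : ℝ), Complex.exp (-ζ * t) * FracCalc.fracD α F t) ∧
    (IntegrableOn (fun t : ℝ => Complex.exp (-ζ * t) * F t) (Ioi 0) ∧
      IntegrableOn
        (fun t : ℝ => Complex.exp (-ζ * t) * ((t : ℂ) ^ α * FracCalc.fracI α F t)) (Ioi 0) ∧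
      ζ * ∫ t in Ioi (0 : ℝ), Complex.exp (-ζ * t) * F t =
        ζ ^ (1 + α) * ∫ t in Ioi (0 : ℝ),
          Complex.exp (-ζ * t) * ((t : ℂ) ^ α * FracCalc.fracI α F t)) := by
  have hζ0 : ζ ≠ 0 := FracCalc.ne_zero_of_lt_re hR hζ
  have hζα : ζ ^ α ≠ 0 := by simp [Complex.cpow_eq_zero_iff, hζ0]
  have h0 : -1 < (0 : ℂ).re := by simp
  have hint : ∀ G ∈ FracCalc.H a R,
      IntegrableOn (fun t : ℝ => Complex.exp (-ζ * t) * G t) (Ioi 0) := fun G hG => by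
    simpa using FracCalc.integrableOn_laplace ha hG h0 hζ
  obtain ⟨G, hG, hGL⟩ := FracCalc.exists_fracD ha hR hα hF
  obtain ⟨K, hK, hKL⟩ := FracCalc.exists_fracI ha hR hα hF
  have hD : ∀ t ∈ Ioi (0 : ℝ), Complex.exp (-ζ * t) * G t =
      Complex.exp (-ζ * t) * FracCalc.fracD α F t := fun t ht => by
    rw [FracCalc.fracD, FracCalc.laplace_eq_laplaceAlpha_zero,
      FracCalc.invOp_laplaceAlpha_eq h0 ha hR hG ⟨R, fun z hz => ?_⟩ ht]
    rw [← FracCalc.laplace_eq_laplaceAlpha_zero]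
    simp only [FracCalc.laplace, FracCalc.laplaceAlpha, hGL z hz]
    ring
  have hI : ∀ t ∈ Ioi (0 : ℝ), Complex.exp (-ζ * t) * ((t : ℂ) ^ α * K t) =
      Complex.exp (-ζ * t) * ((t : ℂ) ^ α * FracCalc.fracI α F t) := fun t ht => by
    rw [FracCalc.fracI, FracCalc.invOp_laplaceAlpha_eq hα ha hR hK ⟨R, fun z hz => ?_⟩ ht]
    simp only [FracCalc.laplace, FracCalc.laplaceAlpha, ← hKL z hz]
    ring
  refine ⟨⟨FracCalc.integrableOn_laplace ha hF hα hζ,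
    (hint G hG).congr_fun hD measurableSet_Ioi, ?_⟩, hint F hF,
    (FracCalc.integrableOn_laplace ha hK hα hζ).congr_fun hI measurableSet_Ioi, ?_⟩
  · rw [← setIntegral_congr_fun measurableSet_Ioi hD, hGL ζ hζ, Complex.cpow_sub _ _ hζ0,
      Complex.cpow_one]
    field_simp
  · rw [← setIntegral_congr_fun measurableSet_Ioi hI, ← hKL ζ hζ, Complex.cpow_add _ _ hζ0,
      Complex.cpow_one, mul_assoc]
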